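/- Let $l>-1$ and let $\phi$ be a non-negative $C^1$ function on $(0,\infty)$ which is integrable on $(0,1]$ and does not vanish identically near $0$. For $\omega>0$ put $$g(\omega)=\int_0^\omega \phi(E)\,(\omega-E)^{l+1/2}\,dE>0,\qquad n(\omega)=-l+\frac{d\log g(\omega)}{d\log\omega},$$ and for $\Omega\in(0,1)$ write $n(\Omega)$ for $n(\omega)$ at $\omega=\Omega/(1-\Omega)$. Consider the system $$\frac{dU}{d\lambda}=U(1-U)\big[(1-Q)\big(3+2l-(4+2l)U\big)-(n(\Omega)+l)\,Q(1-U)\big],$$ $$\frac{dQ}{d\lambda}=Q(1-Q)\big[(2U-1)(1-Q)+Q(1-U)\big],\qquad \frac{d\Omega}{d\lambda}=-\Omega(1-\Omega)Q(1-U).$$ An interior orbit is a solution with values in $(0,1)^3$ that is defined for all $\lambda\ge\lambda_0$, for some $\lambda_0\in\mathbb{R}$; its $\omega$-limit is the set of all limits in $\mathbb{R}^3$ of the solution along sequences $\lambda_k\to\infty$. Let $0<\Omega_0<1$. 1. If $n(\Omega)\le 3+l$ for all $0<\Omega\le\Omega_0$, then the $\omega$-limit of every interior orbit is contained in $\{Q=1,\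 \Omega=0\}$. 2. If, for some $\epsilon>0$, $-l+\epsilon\le n(\Omega)\le 3+l$ for all $0<\Omega\le\Omega_0$, then the $\omega$-limit of every interior orbit is the point $(U,Q,\Omega)=(0,1,0)$. 3. If, for some $\epsilon>0$, $n(\Omega)\le -l-\epsilon$ for all $0<\Omega\le\Omega_0$, then the $\omega$-limit of every interior orbit is the point $(U,Q,\Omega)=(1,1,0)$. -/

import Mathlib

namespace VlasovPoisson

open Set Filter Topology

noncomputable section

/-- `gFun φ m ω = ∫₀^ω φ(E) (ω - E)^m dE`. For the distribution function
`f(E, L²) = φ(E) L^{2l}` the mass density is `C_l r^{2l} g_{l+1/2}(ω)`. -/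
def gFun (φ : ℝ → ℝ) (m ω : ℝ) : ℝ :=
  ∫ E in (0 : ℝ)..ω, φ E * (ω - E) ^ m

/-- The polytropic index function as a function of `ω`:
`n(ω) = -l + d log g_{l+1/2} / d log ω`. -/
def polyIndex (φ : ℝ → ℝ) (l ω : ℝ) : ℝ :=
  -l + ω * deriv (gFun φ (l + 1 / 2)) ω / gFun φ (l + 1 / 2) ω

/-- The polytropic index as a function of the compactified variable `Ω = ω / (1 + ω)`,
that is `ω = Ω / (1 - Ω)`. -/
def polyIndexΩ (φ : ℝ → ℝ) (l Ω : ℝ) : ℝ :=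
  polyIndex φ l (Ω / (1 - Ω))

/-- Admissible energy profiles `φ` for the exponent `l`: non-negative and continuously
differentiable on `(0, ∞)`, integrable near `0`, and with `g_{l+1/2} > 0` on `(0, ∞)`
(`φ` does not vanish identically near `0`), so that `n(ω)` is defined for every `ω > 0`. -/
structure AdmissibleProfile (φ : ℝ → ℝ) (l : ℝ) : Prop where
  nonneg : ∀ E : ℝ, 0 < E → 0 ≤ φ E
  contDiffOn : ContDiffOn ℝ 1 φ (Ioi 0)
  integrableOn : MeasureTheory.IntegrableOn φ (Ioc 0 1)
  pos : ∀ ω : ℝ, 0 < ω → 0 < gFun φ (l + 1 / 2) ω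

/-- The vector field of the `(U, Q, Ω)` system, at the point `p = (U, Q, Ω)`. -/
def field (φ : ℝ → ℝ) (l : ℝ) (p : ℝ × ℝ × ℝ) : ℝ × ℝ × ℝ :=
  let U := p.1
  let Q := p.2.1
  let Ω := p.2.2
  (U * (1 - U) * ((1 - Q) * (3 + 2 * l - (4 + 2 * l) * U)
      - (polyIndexΩ φ l Ω + l) * Q * (1 - U)),
    Q * (1 - Q) * ((2 * U - 1) * (1 - Q) + Q * (1 - U)),
    -Ω * (1 - Ω) * Q * (1 - U))

/-- The open cube `(0, 1)³`. -/
def interiorCube : Set (ℝ × ℝ × ℝ) :=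
  Ioo 0 1 ×ˢ Ioo 0 1 ×ˢ Ioo 0 1

/-- `x` parametrizes an interior (forward) orbit from the parameter value `t₀` on: it solves
the `(U, Q, Ω)` system on `[t₀, ∞)` and takes its values in the open cube. Solutions on the
whole real line are included. -/
def IsInteriorOrbit (φ : ℝ → ℝ) (l t₀ : ℝ) (x : ℝ → ℝ × ℝ × ℝ) : Prop :=
  IsIntegralCurveOn x (fun _ => field φ l) (Ici t₀) ∧ ∀ t ∈ Ici t₀, x t ∈ interiorCube

/-- The ω-limit set of a curve, taken in `ℝ³`: the points that are approached along some
sequence of parameter values tending to `+∞`. -/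
def omegaLimitSet (x : ℝ → ℝ × ℝ × ℝ) : Set (ℝ × ℝ × ℝ) :=
  {p | MapClusterPt p atTop x}

end

end VlasovPoisson

/-!
With `a = 3 + 2 l`, the variables `U / (1 - U)`, `Q / (1 - Q)`, `Ω / (1 - Ω)` are the homology
invariants `u = r ^ a g(ω) / M`, `q = M / (r ω)` and the potential `ω` of a self-gravitating gas
ball with `dM/dr = r ^ (a - 1) g(ω)` and `dω/dr = -M / r ^ 2`. Conversely an interior orbit
determines `r` and `M` algebraically, and these equations hold along it
(`IsInteriorOrbit.exists_newtonianFlow`). No derivative of `g` is left in them: the index enters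
`U'` only through the logarithmic derivative of `g(ω)`. Of `φ` one therefore needs just that `g` is
positive and differentiable on `(0, ∞)` (`AdmissibleProfile.differentiableAt_gFun`).

* `ω → 0`. Otherwise `g(ω)` is bounded below, so `M ≥ c r ^ a`, and integrating
  `dω/dr ≤ -c r ^ (a - 2)` bounds `r`, since `a > 1`; then `M`, `u` and `q` are bounded and `r`
  grows at a definite rate, a contradiction (`NewtonianFlow.tendsto_ω`).
* `n ≤ 3 + l` near zero says that the logarithmic derivative of `g` is at most `a`, whence
  `g(ω) ≥ c ω ^ a`. If `r` were unbounded, `ω ≥ M / r` would give `dM / d log r ≥ c M ^ a`, which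
  blows up at finite `log r` (`NewtonianFlow.exists_r_le`). So the radius is finite, and
  `q = M / (r ω) → ∞` because `M` increases; that is `Q → 1`.
* `n ≥ -l + ε` gives `g(ω) ≤ C ω ^ ε → 0`, so `u → 0` and `U → 0`.
* `n ≤ -l - ε` makes `g` decreasing with `g(ω) → ∞` as `ω → 0`. Integrating
  `M dM ≤ R ^ (a + 1) g(ω) (-dω)`, where `R` bounds `r`, gives `M ^ 2 ≤ A + B g(ω)`, so `u` grows
  at least like the square root of `g(ω)`, and `U → 1`.
-/

namespace VlasovPoisson

open Set Filter Topology

/-! ### Differentiability of the density integral -/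

lemma AdmissibleProfile.intervalIntegrable {φ : ℝ → ℝ} {l : ℝ} (hφ : AdmissibleProfile φ l)
    {b : ℝ} (hb : 0 < b) : IntervalIntegrable φ MeasureTheory.volume 0 b := by
  have h1 : IntervalIntegrable φ MeasureTheory.volume 0 1 :=
    (intervalIntegrable_iff_integrableOn_Ioc_of_le zero_le_one).2 hφ.integrableOn
  refine h1.trans (ContinuousOn.intervalIntegrable (hφ.contDiffOn.continuousOn.mono ?_))
  intro x hx
  exact lt_of_lt_of_le (lt_min one_pos hb) hx.1

/-- The energies `E ≤ δ < ω` stay away from the singularity of the kernel at `E = ω`, so the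
`ω`-derivative falls on the kernel and integrability of `φ` suffices. -/
lemma differentiableAt_integral_low {φ : ℝ → ℝ} {δ : ℝ} (hδ : 0 < δ)
    (hφ : IntervalIntegrable φ MeasureTheory.volume 0 δ) (m : ℝ) {ω₀ : ℝ} (hω : δ < ω₀) :
    DifferentiableAt ℝ (fun ω => ∫ E in (0 : ℝ)..δ, φ E * (ω - E) ^ m) ω₀ := by
  set η := (ω₀ - δ) / 2 with hη
  have hη0 : 0 < η := by rw [hη]; linarith
  have hkernel : ∀ (k : ℝ) (ω : ℝ), δ < ω → ContinuousOn (fun E => (ω - E) ^ k) (uIcc 0 δ) := by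
    intro k ω hω x hx
    rw [uIcc_of_le hδ.le] at hx
    exact (ContinuousAt.rpow_const (by fun_prop) (Or.inl (by linarith [hx.2]))).continuousWithinAt
  obtain ⟨C, hC⟩ := (isCompact_Icc (a := η) (b := ω₀ + η)).exists_bound_of_continuousOn
    (f := fun s : ℝ => m * s ^ (m - 1)) (by
      intro s hs
      exact (continuousAt_const.mul
        (continuousAt_id.rpow_const (Or.inl (by simp; linarith [hs.1])))).continuousWithinAt)
  refine (intervalIntegral.hasDerivAt_integral_of_dominated_loc_of_deriv_le
    (F := fun ω E => φ E * (ω - E) ^ m) (F' := fun ω E => φ E * (m * (ω - E) ^ (m - 1)))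
    (bound := fun E => ‖φ E‖ * C) (s := Metric.ball ω₀ η) (Metric.ball_mem_nhds _ hη0)
    ?_ ?_ ?_ ?_ ?_ ?_).2.differentiableAt
  · filter_upwards [lt_mem_nhds hω] with ω h
    have := (hφ.mul_continuousOn (hkernel m ω h)).aestronglyMeasurable
    rwa [uIoc_of_le hδ.le]
  · exact hφ.mul_continuousOn (hkernel m ω₀ hω)
  · have := (hφ.mul_continuousOn
      ((continuousOn_const (c := m)).mul (hkernel (m - 1) ω₀ hω))).aestronglyMeasurable
    rwa [uIoc_of_le hδ.le]
  · refine Eventually.of_forall fun E hE ω h => ?_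
    rw [uIoc_of_le hδ.le] at hE
    rw [Metric.mem_ball, Real.dist_eq, abs_lt] at h
    rw [norm_mul]
    exact mul_le_mul_of_nonneg_left
      (hC _ ⟨by linarith [hE.2, h.1], by linarith [hE.1, h.2]⟩) (norm_nonneg _)
  · exact hφ.norm.mul_const C
  · refine Eventually.of_forall fun E hE ω h => ?_
    rw [uIoc_of_le hδ.le] at hE
    rw [Metric.mem_ball, Real.dist_eq, abs_lt] at h
    have hpos : ω - E ≠ 0 := by linarith [hE.2, h.1]
    have := (((hasDerivAt_id ω).sub_const E).rpow_const (p := m) (Or.inl hpos)).const_mul (φ E)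
    simpa using this

/-- Rescaling the energies in `(δ, ω)` to the fixed interval `(0, 1)` moves the `ω`-dependence
from the singular kernel to the smooth factor `φ`. -/
lemma integral_high_eq (φ : ℝ → ℝ) {m δ ω : ℝ} (hω : δ < ω) :
    ∫ E in δ..ω, φ E * (ω - E) ^ m =
      (ω - δ) * (ω - δ) ^ m * ∫ σ in (0 : ℝ)..1, φ (ω - (ω - δ) * σ) * σ ^ m := by
  have h := intervalIntegral.smul_integral_comp_sub_mul (a := 0) (b := 1)
    (fun E => φ E * (ω - E) ^ m) (ω - δ) ω
  simp only [mul_one, sub_sub_cancel, mul_zero, sub_zero, smul_eq_mul] at h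
  rw [← h, mul_assoc,
    ← intervalIntegral.integral_const_mul ((ω - δ) ^ m)]
  refine congrArg _ (intervalIntegral.integral_congr fun σ hσ => ?_)
  rw [uIcc_of_le zero_le_one] at hσ
  rw [Real.mul_rpow (by linarith) hσ.1]
  ring

lemma differentiableAt_integral_high {φ : ℝ → ℝ} (hφ : ContDiffOn ℝ 1 φ (Ioi 0)) {m : ℝ}
    (hm : -1 < m) {δ : ℝ} (hδ : 0 < δ) {ω₀ : ℝ} (hω : δ < ω₀) :
    DifferentiableAt ℝ (fun ω => ∫ E in δ..ω, φ E * (ω - E) ^ m) ω₀ := by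
  have hpow : DifferentiableAt ℝ (fun ω : ℝ => (ω - δ) * (ω - δ) ^ m) ω₀ := by
    have : ω₀ - δ ≠ 0 := by linarith
    exact (by fun_prop : DifferentiableAt ℝ (fun ω : ℝ => ω - δ) ω₀).mul
      ((by fun_prop : DifferentiableAt ℝ (fun ω : ℝ => ω - δ) ω₀).rpow_const (Or.inl this))
  have hφ' := hφ.continuousOn_deriv_of_isOpen isOpen_Ioi le_rfl
  set η := ω₀ - δ with hη
  have hη0 : 0 < η := by rw [hη]; linarith
  -- the rescaled energies stay in a compact part of `(0, ∞)`
  have harg : ∀ ω ∈ Metric.ball ω₀ η, ∀ σ ∈ Icc (0 : ℝ) 1,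
      ω - (ω - δ) * σ ∈ Icc δ (ω₀ + η) := by
    intro ω h σ hσ
    rw [Metric.mem_ball, Real.dist_eq, abs_lt] at h
    constructor <;> nlinarith [hσ.1, hσ.2, h.1, h.2,
      mul_nonneg (by linarith [h.1] : 0 ≤ ω - δ) hσ.1,
      mul_nonneg (by linarith [h.1] : 0 ≤ ω - δ) (by linarith [hσ.2] : 0 ≤ 1 - σ)]
  have hsub : Icc δ (ω₀ + η) ⊆ Ioi 0 := fun x hx => lt_of_lt_of_le hδ hx.1
  obtain ⟨C, hC⟩ := (isCompact_Icc (a := δ) (b := ω₀ + η)).exists_bound_of_continuousOn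
    (hφ'.mono hsub)
  have hrpow : IntervalIntegrable (fun σ : ℝ => σ ^ m) MeasureTheory.volume 0 1 :=
    intervalIntegral.intervalIntegrable_rpow' hm
  have hscale : ∀ ω, ContinuousOn (fun σ : ℝ => ω - (ω - δ) * σ) (uIcc 0 1) := fun ω => by fun_prop
  have hcont : ∀ {f : ℝ → ℝ}, ContinuousOn f (Ioi 0) → ∀ ω ∈ Metric.ball ω₀ η,
      ContinuousOn (fun σ : ℝ => f (ω - (ω - δ) * σ)) (uIcc 0 1) := by
    intro f hf ω h
    refine hf.comp (hscale ω) fun σ hσ => ?_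
    rw [uIcc_of_le zero_le_one] at hσ
    exact hsub (harg ω h σ hσ)
  have hint : DifferentiableAt ℝ
      (fun ω => ∫ σ in (0 : ℝ)..1, φ (ω - (ω - δ) * σ) * σ ^ m) ω₀ := by
    refine (intervalIntegral.hasDerivAt_integral_of_dominated_loc_of_deriv_le
      (F := fun ω σ => φ (ω - (ω - δ) * σ) * σ ^ m)
      (F' := fun ω σ => deriv φ (ω - (ω - δ) * σ) * (1 - σ) * σ ^ m)
      (bound := fun σ => C * σ ^ m) (s := Metric.ball ω₀ η) (Metric.ball_mem_nhds _ hη0)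
      ?_ ?_ ?_ ?_ ?_ ?_).2.differentiableAt
    · filter_upwards [Metric.ball_mem_nhds ω₀ hη0] with ω h
      have := (hrpow.continuousOn_mul (hcont hφ.continuousOn ω h)).aestronglyMeasurable
      rwa [uIoc_of_le zero_le_one]
    · exact hrpow.continuousOn_mul (hcont hφ.continuousOn ω₀ (Metric.mem_ball_self hη0))
    · have := (hrpow.continuousOn_mul ((hcont hφ' ω₀ (Metric.mem_ball_self hη0)).mul
        (by fun_prop : ContinuousOn (fun σ : ℝ => 1 - σ) (uIcc 0 1)))).aestronglyMeasurable
      rwa [uIoc_of_le zero_le_one]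
    · refine Eventually.of_forall fun σ hσ ω h => ?_
      rw [uIoc_of_le zero_le_one] at hσ
      have h1 := hC _ (harg ω h σ ⟨hσ.1.le, hσ.2⟩)
      have h2 : ‖1 - σ‖ ≤ 1 := by
        rw [Real.norm_eq_abs, abs_le]; constructor <;> linarith [hσ.1, hσ.2]
      have h3 : 0 ≤ σ ^ m := Real.rpow_nonneg hσ.1.le m
      rw [norm_mul, norm_mul, Real.norm_of_nonneg h3]
      refine mul_le_mul_of_nonneg_right ?_ h3
      exact (mul_le_mul h1 h2 (norm_nonneg _) ((norm_nonneg _).trans h1)).trans_eq (mul_one C)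
    · exact hrpow.const_mul C
    · refine Eventually.of_forall fun σ hσ ω h => ?_
      rw [uIoc_of_le zero_le_one] at hσ
      have hpos := hsub (harg ω h σ ⟨hσ.1.le, hσ.2⟩)
      have hd := ((hφ.differentiableOn one_ne_zero).differentiableAt
        (isOpen_Ioi.mem_nhds hpos)).hasDerivAt
      have hin : HasDerivAt (fun ω : ℝ => ω - (ω - δ) * σ) (1 - σ) ω := by
        simpa using (hasDerivAt_id' ω).fun_sub (((hasDerivAt_id' ω).sub_const δ).mul_const σ)
      exact (hd.comp ω hin).mul_const _
  refine (hpow.mul hint).congr_of_eventuallyEq ?_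
  filter_upwards [lt_mem_nhds hω] with ω h
  exact integral_high_eq φ h

theorem AdmissibleProfile.differentiableAt_gFun {φ : ℝ → ℝ} {l : ℝ} (hl : -1 < l)
    (hφ : AdmissibleProfile φ l) {ω₀ : ℝ} (hω₀ : 0 < ω₀) :
    DifferentiableAt ℝ (gFun φ (l + 1 / 2)) ω₀ := by
  have hm : -1 < l + 1 / 2 := by linarith
  obtain ⟨δ, hδ, hδω⟩ := exists_between hω₀
  refine ((differentiableAt_integral_low hδ (hφ.intervalIntegrable hδ) (l + 1 / 2) hδω).add
    (differentiableAt_integral_high hφ.contDiffOn hm hδ hδω)).congr_of_eventuallyEq ?_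
  filter_upwards [lt_mem_nhds hδω] with ω h
  refine (intervalIntegral.integral_add_adjacent_intervals ?_ ?_).symm
  · refine (hφ.intervalIntegrable hδ).mul_continuousOn fun E hE => ?_
    rw [uIcc_of_le hδ.le] at hE
    exact (ContinuousAt.rpow_const (by fun_prop)
      (Or.inl (by linarith [hE.2]))).continuousWithinAt
  · refine IntervalIntegrable.continuousOn_mul ?_ (hφ.contDiffOn.continuousOn.mono ?_)
    · have := (intervalIntegral.intervalIntegrable_rpow' hm
        (a := ω - δ) (b := ω - ω)).comp_sub_left ω
      simpa using this
    · rw [uIcc_of_le h.le]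
      exact fun x hx => lt_of_lt_of_le hδ hx.1

/-! ### The Newtonian form of the system -/

/-- The structure equations of a self-gravitating gas ball in a time `t ≥ T` that need not be the
radius: `r` is the radius, `M` the mass inside `r`, `ω` the relative potential, and
`r ^ (a - 3) * g ω` the mass density, so that `dM/dr = r ^ (a - 1) g ω` and
`dω/dr = -M / r ^ 2`. The speed `v = dr/dt` is `r / ((1 + u) (1 + q))`, where
`u = r ^ a g ω / M` and `q = M / (r ω)` are the homology invariants. -/
structure NewtonianFlow (a : ℝ) (g r M ω v : ℝ → ℝ) (T : ℝ) : Prop where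
  r_pos : ∀ t, T ≤ t → 0 < r t
  M_pos : ∀ t, T ≤ t → 0 < M t
  ω_pos : ∀ t, T ≤ t → 0 < ω t
  speed : ∀ t, T ≤ t →
    v t = r t / ((1 + r t ^ a * g (ω t) / M t) * (1 + M t / (r t * ω t)))
  deriv_r : ∀ t, T ≤ t → HasDerivAt r (v t) t
  deriv_M : ∀ t, T ≤ t → HasDerivAt M (r t ^ (a - 1) * g (ω t) * v t) t
  deriv_ω : ∀ t, T ≤ t → HasDerivAt ω (-(M t / r t ^ 2) * v t) t

lemma antitoneOn_of_hasDerivAt_nonpos {D : Set ℝ} (hD : Convex ℝ D) {f f' : ℝ → ℝ}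
    (hf : ∀ t ∈ D, HasDerivAt f (f' t) t) (h : ∀ t ∈ D, f' t ≤ 0) : AntitoneOn f D :=
  antitoneOn_of_hasDerivWithinAt_nonpos hD
    (fun t ht => (hf t ht).continuousAt.continuousWithinAt)
    (fun t ht => (hf t (interior_subset ht)).hasDerivWithinAt)
    (fun t ht => h t (interior_subset ht))

lemma monotoneOn_of_hasDerivAt_nonneg {D : Set ℝ} (hD : Convex ℝ D) {f f' : ℝ → ℝ}
    (hf : ∀ t ∈ D, HasDerivAt f (f' t) t) (h : ∀ t ∈ D, 0 ≤ f' t) : MonotoneOn f D :=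
  monotoneOn_of_hasDerivWithinAt_nonneg hD
    (fun t ht => (hf t ht).continuousAt.continuousWithinAt)
    (fun t ht => (hf t (interior_subset ht)).hasDerivWithinAt)
    (fun t ht => h t (interior_subset ht))

namespace NewtonianFlow

variable {a T : ℝ} {g r M ω v : ℝ → ℝ}

lemma restart (h : NewtonianFlow a g r M ω v T) {T' : ℝ} (hT : T ≤ T') :
    NewtonianFlow a g r M ω v T' where
  r_pos t ht := h.r_pos t (hT.trans ht)
  M_pos t ht := h.M_pos t (hT.trans ht)
  ω_pos t ht := h.ω_pos t (hT.trans ht)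
  speed t ht := h.speed t (hT.trans ht)
  deriv_r t ht := h.deriv_r t (hT.trans ht)
  deriv_M t ht := h.deriv_M t (hT.trans ht)
  deriv_ω t ht := h.deriv_ω t (hT.trans ht)

lemma v_pos (h : NewtonianFlow a g r M ω v T) (hg : ∀ w, 0 < w → 0 < g w) {t : ℝ} (ht : T ≤ t) :
    0 < v t := by
  have hr := h.r_pos t ht
  have hM := h.M_pos t ht
  have hω := h.ω_pos t ht
  have hgω := hg _ hω
  rw [h.speed t ht]
  positivity

lemma monotoneOn_r (h : NewtonianFlow a g r M ω v T) (hg : ∀ w, 0 < w → 0 < g w) :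
    MonotoneOn r (Ici T) :=
  monotoneOn_of_hasDerivAt_nonneg (convex_Ici T) h.deriv_r fun _ ht => (h.v_pos hg ht).le

lemma monotoneOn_M (h : NewtonianFlow a g r M ω v T) (hg : ∀ w, 0 < w → 0 < g w) :
    MonotoneOn M (Ici T) :=
  monotoneOn_of_hasDerivAt_nonneg (convex_Ici T) h.deriv_M fun t ht =>
    mul_nonneg (mul_nonneg (Real.rpow_nonneg (h.r_pos t ht).le _) (hg _ (h.ω_pos t ht)).le)
      (h.v_pos hg ht).le

lemma antitoneOn_ω (h : NewtonianFlow a g r M ω v T) (hg : ∀ w, 0 < w → 0 < g w) :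
    AntitoneOn ω (Ici T) := by
  refine antitoneOn_of_hasDerivAt_nonpos (convex_Ici T) h.deriv_ω fun t ht => ?_
  have := mul_nonneg (div_nonneg (h.M_pos t ht).le (sq_nonneg (r t))) (h.v_pos hg ht).le
  linarith

lemma hasDerivAt_rpow_r (h : NewtonianFlow a g r M ω v T) (k : ℝ) {t : ℝ} (ht : T ≤ t) :
    HasDerivAt (fun s => r s ^ k) (v t * k * r t ^ (k - 1)) t :=
  (h.deriv_r t ht).rpow_const (Or.inl (h.r_pos t ht).ne')

/-! ### The potential decays to zero -/

/-- If the potential stays above a positive level, the density profile is bounded below, hence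
`M ≥ c r ^ a`, and `ω` loses at least a multiple of `r ^ (a - 1)`. -/
lemma exists_r_le_of_le_ω (h : NewtonianFlow a g r M ω v T) (ha : 1 < a)
    (hgc : ContinuousOn g (Ioi 0)) (hg : ∀ w, 0 < w → 0 < g w) {w : ℝ} (hw : 0 < w)
    (hωw : ∀ t, T ≤ t → w ≤ ω t) : ∃ R, ∀ t, T ≤ t → r t ≤ R := by
  have hrT := h.r_pos T le_rfl
  have hMT := h.M_pos T le_rfl
  have hmem : ∀ t, T ≤ t → ω t ∈ Icc w (ω T) := fun t ht =>
    ⟨hωw t ht, h.antitoneOn_ω hg self_mem_Ici ht ht⟩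
  obtain ⟨w₀, hw₀, hmin⟩ := isCompact_Icc.exists_isMinOn ⟨_, hmem T le_rfl⟩
    (hgc.mono fun x hx => hw.trans_le hx.1)
  -- the second entry makes `M - c r ^ a` non-negative at time `T`
  set c := min (g w₀ / a) (M T / r T ^ a) with hc
  have hc0 : 0 < c := by
    have := hg w₀ (hw.trans_le hw₀.1)
    rw [hc]
    positivity
  have hcg : ∀ t, T ≤ t → a * c ≤ g (ω t) := fun t ht => by
    have h1 : c ≤ g w₀ / a := min_le_left _ _
    rw [le_div_iff₀ (by linarith)] at h1
    have h2 : g w₀ ≤ g (ω t) := hmin (hmem t ht)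
    linarith
  have hMr : ∀ t, T ≤ t → c * r t ^ a ≤ M t := by
    have hmono : MonotoneOn (fun t => M t - c * r t ^ a) (Ici T) := by
      refine monotoneOn_of_hasDerivAt_nonneg (convex_Ici T) (fun t ht =>
        (h.deriv_M t ht).fun_sub ((h.hasDerivAt_rpow_r a ht).const_mul c)) fun t ht => ?_
      have h1 := mul_nonneg (mul_nonneg (Real.rpow_nonneg (h.r_pos t ht).le (a - 1))
        (h.v_pos hg ht).le) (sub_nonneg.2 (hcg t ht))
      linarith
    intro t ht
    have h1 := hmono self_mem_Ici ht ht
    have h2 : c * r T ^ a ≤ M T := by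
      rw [← le_div_iff₀ (by positivity)]
      exact min_le_right _ _
    simp only at h1
    linarith
  have hanti : AntitoneOn (fun t => ω t + c / (a - 1) * r t ^ (a - 1)) (Ici T) := by
    refine antitoneOn_of_hasDerivAt_nonpos (convex_Ici T) (fun t ht =>
      (h.deriv_ω t ht).fun_add ((h.hasDerivAt_rpow_r (a - 1) ht).const_mul _)) fun t ht => ?_
    have hr := h.r_pos t ht
    have hv := h.v_pos hg ht
    have e1 : r t ^ a = r t ^ (a - 1 - 1) * r t ^ 2 := by
      rw [← Real.rpow_natCast, ← Real.rpow_add hr]; congr 1; push_cast; ring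
    have h1 : c * r t ^ (a - 1 - 1) ≤ M t / r t ^ 2 := by
      rw [le_div_iff₀ (by positivity), mul_assoc, ← e1]
      exact hMr t ht
    have e2 : c / (a - 1) * (v t * (a - 1) * r t ^ (a - 1 - 1)) = c * r t ^ (a - 1 - 1) * v t := by
      have : a - 1 ≠ 0 := by linarith
      field_simp
    rw [e2]
    nlinarith
  have ha1 : 0 < a - 1 := by linarith
  refine ⟨((ω T + c / (a - 1) * r T ^ (a - 1)) / (c / (a - 1))) ^ (a - 1)⁻¹, fun t ht => ?_⟩
  have h1 := hanti self_mem_Ici ht ht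
  simp only at h1
  have h2 : r t ^ (a - 1) ≤ (ω T + c / (a - 1) * r T ^ (a - 1)) / (c / (a - 1)) := by
    rw [le_div_iff₀ (by positivity), mul_comm]
    linarith [h.ω_pos t ht]
  have hr := h.r_pos t ht
  calc r t = (r t ^ (a - 1)) ^ (a - 1)⁻¹ := (Real.rpow_rpow_inv hr.le ha1.ne').symm
    _ ≤ _ := Real.rpow_le_rpow (by positivity) h2 (by positivity)

/-- The orbit cannot stay above a positive potential: at bounded radius the mass and the
homology invariants would be bounded, so that `r` would grow at a definite rate. -/
lemma exists_ω_lt (h : NewtonianFlow a g r M ω v T) (ha : 1 < a)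
    (hgc : ContinuousOn g (Ioi 0)) (hg : ∀ w, 0 < w → 0 < g w) {w : ℝ} (hw : 0 < w) :
    ∃ t, T ≤ t ∧ ω t < w := by
  by_contra! hωw
  obtain ⟨R, hR⟩ := h.exists_r_le_of_le_ω ha hgc hg hw hωw
  have hrT := h.r_pos T le_rfl
  have hMT := h.M_pos T le_rfl
  have hR0 : 0 < R := hrT.trans_le (hR T le_rfl)
  have hmem : ∀ t, T ≤ t → ω t ∈ Icc w (ω T) := fun t ht =>
    ⟨hωw t ht, h.antitoneOn_ω hg self_mem_Ici ht ht⟩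
  obtain ⟨w₁, hw₁, hmax⟩ := isCompact_Icc.exists_isMaxOn ⟨_, hmem T le_rfl⟩
    (hgc.mono fun x hx => hw.trans_le hx.1)
  set G := g w₁ with hG
  have hG0 : 0 < G := hg w₁ (hw.trans_le hw₁.1)
  have hgG : ∀ t, T ≤ t → g (ω t) ≤ G := fun t ht => hmax (hmem t ht)
  have hra : ∀ t, T ≤ t → r t ^ a ≤ R ^ a := fun t ht =>
    Real.rpow_le_rpow (h.r_pos t ht).le (hR t ht) (by linarith)
  set B := M T + G / a * R ^ a with hB
  have hB0 : 0 < B := by positivity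
  have hM : ∀ t, T ≤ t → M t ≤ B := by
    have hanti : AntitoneOn (fun t => M t - G / a * r t ^ a) (Ici T) := by
      refine antitoneOn_of_hasDerivAt_nonpos (convex_Ici T) (fun t ht =>
        (h.deriv_M t ht).fun_sub ((h.hasDerivAt_rpow_r a ht).const_mul _)) fun t ht => ?_
      have h1 := mul_nonneg (mul_nonneg (Real.rpow_nonneg (h.r_pos t ht).le (a - 1))
        (h.v_pos hg ht).le) (sub_nonneg.2 (hgG t ht))
      have e : G / a * (v t * a * r t ^ (a - 1)) = G * v t * r t ^ (a - 1) := by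
        field_simp
      rw [e]
      linarith
    intro t ht
    have h1 := hanti self_mem_Ici ht ht
    simp only at h1
    have h2 : G / a * r t ^ a ≤ G / a * R ^ a :=
      mul_le_mul_of_nonneg_left (hra t ht) (by positivity)
    have h3 : 0 ≤ G / a * r T ^ a := by positivity
    linarith
  set c := r T / ((1 + R ^ a * G / M T) * (1 + B / (r T * w))) with hc
  have hc0 : 0 < c := by positivity
  have hv : ∀ t, T ≤ t → c ≤ v t := by
    intro t ht
    have hr := h.r_pos t ht
    have hMt := h.M_pos t ht
    have hωt := h.ω_pos t ht
    have hgt := hg _ hωt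
    have hrm := h.monotoneOn_r hg self_mem_Ici ht ht
    have hMm := h.monotoneOn_M hg self_mem_Ici ht ht
    rw [h.speed t ht, hc]
    gcongr
    · exact hR t ht
    · exact hgG t ht
    · exact hM t ht
    · exact hωw t ht
  have hmono : MonotoneOn (fun t => r t - c * t) (Ici T) :=
    monotoneOn_of_hasDerivAt_nonneg (convex_Ici T) (fun t ht =>
      (h.deriv_r t ht).fun_sub ((hasDerivAt_id' t).const_mul c)) fun t ht => by
        linarith [hv t ht]
  have hT : T ≤ T + R / c := by
    have : 0 < R / c := by positivity
    linarith
  have h1 := hmono self_mem_Ici hT hT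
  have h2 := hR _ hT
  simp only at h1
  have e : c * (T + R / c) = c * T + R := by field_simp
  linarith

theorem tendsto_ω (h : NewtonianFlow a g r M ω v T) (ha : 1 < a)
    (hgc : ContinuousOn g (Ioi 0)) (hg : ∀ w, 0 < w → 0 < g w) :
    Tendsto ω atTop (𝓝[>] 0) := by
  rw [tendsto_nhdsWithin_iff]
  refine ⟨tendsto_order.2 ⟨fun w hw => ?_, fun w hw => ?_⟩, ?_⟩
  · filter_upwards [eventually_ge_atTop T] with t ht using hw.trans (h.ω_pos t ht)
  · obtain ⟨s, hs, hsw⟩ := h.exists_ω_lt ha hgc hg hw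
    filter_upwards [eventually_ge_atTop s] with t ht
    exact (h.antitoneOn_ω hg hs (hs.trans ht) ht).trans_lt hsw
  · filter_upwards [eventually_ge_atTop T] with t ht using h.ω_pos t ht

/-! ### Finite radius -/

/-- The potential at `t` is at least the work `∫ M / r ^ 2 dr ≥ M t / r t` done by the mass
inside `r t` alone, if the radius is unbounded. -/
lemma M_div_r_le_ω (h : NewtonianFlow a g r M ω v T) (hg : ∀ w, 0 < w → 0 < g w)
    (hunb : ∀ R, ∃ t, T ≤ t ∧ R < r t) {t : ℝ} (ht : T ≤ t) : M t / r t ≤ ω t := by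
  by_contra! hlt
  have hM := h.M_pos t ht
  obtain ⟨s, hs, hsr⟩ := hunb (max (r t) (M t / (M t / r t - ω t)))
  rw [max_lt_iff] at hsr
  have hts : t ≤ s := by
    by_contra! hst
    exact (h.monotoneOn_r hg hs ht hst.le).not_gt hsr.1
  have hanti : AntitoneOn (fun s => ω s - M t * (r s)⁻¹) (Ici t) := by
    refine antitoneOn_of_hasDerivAt_nonpos (convex_Ici t) (fun s hs =>
      (h.deriv_ω s (ht.trans hs)).fun_sub
        (((h.deriv_r s (ht.trans hs)).fun_inv (h.r_pos s (ht.trans hs)).ne').const_mul (M t)))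
      fun s hs => ?_
    have hTs : T ≤ s := ht.trans hs
    have hr := h.r_pos s hTs
    have hMm : 0 ≤ M s - M t := sub_nonneg.2 (h.monotoneOn_M hg ht hTs hs)
    have hv := (h.v_pos hg hTs).le
    have e : -(M s / r s ^ 2) * v s - M t * (-v s / r s ^ 2) = -((M s - M t) * v s / r s ^ 2) := by
      ring
    rw [e]
    exact neg_nonpos.2 (by positivity)
  have h1 := hanti self_mem_Ici hts hts
  simp only [← div_eq_mul_inv] at h1
  have h2 : M t / r s < M t / r t - ω t := by
    rw [div_lt_iff₀ (h.r_pos s hs)]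
    have := hsr.2
    rwa [div_lt_iff₀ (by linarith), mul_comm] at this
  linarith [h.ω_pos s hs]

/-- If `g w ≥ c w ^ a` near zero, the radius stays bounded. Otherwise `ω ≥ M / r` gives
`dM / d log r ≥ c M ^ a`, and as `a > 1` the mass would blow up at a finite value of `log r`. -/
theorem exists_r_le (h : NewtonianFlow a g r M ω v T) (ha : 1 < a)
    (hg : ∀ w, 0 < w → 0 < g w) {c : ℝ} (hc : 0 < c)
    (hgl : ∀ w ∈ Ioc 0 (ω T), c * w ^ a ≤ g w) : ∃ R, ∀ t, T ≤ t → r t ≤ R := by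
  by_contra! hunb
  have ha1 : 0 < a - 1 := by linarith
  have hanti : AntitoneOn (fun t => (a - 1)⁻¹ * M t ^ (1 - a) + c * Real.log (r t)) (Ici T) := by
    refine antitoneOn_of_hasDerivAt_nonpos (convex_Ici T) (fun t ht =>
      (((h.deriv_M t ht).rpow_const (p := 1 - a) (Or.inl (h.M_pos t ht).ne')).const_mul _).fun_add
        (((h.deriv_r t ht).log (h.r_pos t ht).ne').const_mul c)) fun t ht => ?_
    have hr := h.r_pos t ht
    have hM := h.M_pos t ht
    have hv := h.v_pos hg ht
    have h1 : c * (M t / r t) ^ a ≤ g (ω t) :=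
      (mul_le_mul_of_nonneg_left (Real.rpow_le_rpow (by positivity)
        (h.M_div_r_le_ω hg hunb ht) (by linarith)) hc.le).trans
        (hgl _ ⟨h.ω_pos t ht, h.antitoneOn_ω hg self_mem_Ici ht ht⟩)
    have e1 : (a - 1)⁻¹ * (r t ^ (a - 1) * g (ω t) * v t * (1 - a) * M t ^ (1 - a - 1)) =
        -(r t ^ a / r t * g (ω t) * v t * (M t ^ a)⁻¹) := by
      rw [Real.rpow_sub hr, Real.rpow_one, show 1 - a - 1 = -a by ring, Real.rpow_neg hM.le]
      field_simp
      ring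
    have e2 : c * (v t / r t) =
        r t ^ a / r t * (c * (M t / r t) ^ a) * v t * (M t ^ a)⁻¹ := by
      rw [Real.div_rpow hM.le hr.le]
      field_simp
    rw [e1, e2]
    have h2 : r t ^ a / r t * (c * (M t / r t) ^ a) * v t * (M t ^ a)⁻¹ ≤
        r t ^ a / r t * g (ω t) * v t * (M t ^ a)⁻¹ := by gcongr
    linarith
  obtain ⟨t, ht, hrt⟩ := hunb
    (Real.exp (((a - 1)⁻¹ * M T ^ (1 - a) + c * Real.log (r T)) / c))
  have h1 := hanti self_mem_Ici ht ht
  have h2 := (Real.lt_log_iff_exp_lt (h.r_pos t ht)).2 hrt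
  rw [div_lt_iff₀ hc] at h2
  have h3 : 0 ≤ (a - 1)⁻¹ * M t ^ (1 - a) :=
    mul_nonneg (inv_nonneg.2 ha1.le) (Real.rpow_nonneg (h.M_pos t ht).le _)
  simp only at h1
  linarith

/-! ### Limits of the homology invariants at finite radius -/

theorem tendsto_q (h : NewtonianFlow a g r M ω v T) (hg : ∀ w, 0 < w → 0 < g w) {R : ℝ}
    (hR : ∀ t, T ≤ t → r t ≤ R) (hω : Tendsto ω atTop (𝓝[>] 0)) :
    Tendsto (fun t => M t / (r t * ω t)) atTop atTop := by
  have hMT := h.M_pos T le_rfl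
  have hR0 : 0 < R := (h.r_pos T le_rfl).trans_le (hR T le_rfl)
  refine tendsto_atTop_mono' atTop ?_
    ((tendsto_inv_nhdsGT_zero.comp hω).const_mul_atTop (div_pos hMT hR0))
  filter_upwards [eventually_ge_atTop T] with t ht
  have hr := h.r_pos t ht
  have hM := h.M_pos t ht
  have hωt := h.ω_pos t ht
  have hMm := h.monotoneOn_M hg self_mem_Ici ht ht
  calc M T / R * (ω t)⁻¹ = M T / (R * ω t) := by field_simp
    _ ≤ M t / (r t * ω t) := by gcongr; exact hR t ht

theorem tendsto_u_zero (h : NewtonianFlow a g r M ω v T) (ha : 0 ≤ a)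
    (hg : ∀ w, 0 < w → 0 < g w) {R : ℝ} (hR : ∀ t, T ≤ t → r t ≤ R)
    (hgω : Tendsto (fun t => g (ω t)) atTop (𝓝 0)) :
    Tendsto (fun t => r t ^ a * g (ω t) / M t) atTop (𝓝 0) := by
  have hMT := h.M_pos T le_rfl
  have hR0 : 0 < R := (h.r_pos T le_rfl).trans_le (hR T le_rfl)
  have hlim : Tendsto (fun t => R ^ a / M T * g (ω t)) atTop (𝓝 0) := by
    simpa using hgω.const_mul (R ^ a / M T)
  refine tendsto_of_tendsto_of_tendsto_of_le_of_le' tendsto_const_nhds hlim ?_ ?_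
  · filter_upwards [eventually_ge_atTop T] with t ht
    have hr := h.r_pos t ht
    have hM := h.M_pos t ht
    have hgt := hg _ (h.ω_pos t ht)
    positivity
  · filter_upwards [eventually_ge_atTop T] with t ht
    have hr := h.r_pos t ht
    have hgt := hg _ (h.ω_pos t ht)
    have hMm := h.monotoneOn_M hg self_mem_Ici ht ht
    calc r t ^ a * g (ω t) / M t ≤ R ^ a * g (ω t) / M T := by
          refine div_le_div₀ (by positivity) ?_ hMT hMm
          gcongr
          exact hR t ht
      _ = R ^ a / M T * g (ω t) := by ring

/-- If `g` decreases, then `M dM ≤ R ^ (a + 1) g(ω) (-dω)` bounds `M ^ 2` by an affine function of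
the current value of `g`. -/
lemma M_sq_le (h : NewtonianFlow a g r M ω v T) (ha : 1 < a) (hg : ∀ w, 0 < w → 0 < g w)
    {R : ℝ} (hR : ∀ t, T ≤ t → r t ≤ R) (hanti : AntitoneOn g (Ioc 0 (ω T))) {t : ℝ}
    (ht : T ≤ t) : M t ^ 2 ≤ M T ^ 2 + 2 * R ^ (a + 1) * ω T * g (ω t) := by
  have hR0 : 0 < R := (h.r_pos T le_rfl).trans_le (hR T le_rfl)
  have hgt := hg _ (h.ω_pos t ht)
  have hωmem : ∀ s, T ≤ s → ω s ∈ Ioc 0 (ω T) := fun s hs =>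
    ⟨h.ω_pos s hs, h.antitoneOn_ω hg self_mem_Ici hs hs⟩
  have hdec : AntitoneOn (fun s => M s ^ 2 + 2 * R ^ (a + 1) * g (ω t) * ω s) (Icc T t) := by
    refine antitoneOn_of_hasDerivAt_nonpos (convex_Icc T t) (fun s hs =>
      ((h.deriv_M s hs.1).fun_pow 2).fun_add ((h.deriv_ω s hs.1).const_mul _)) fun s hs => ?_
    have hr := h.r_pos s hs.1
    have hM := h.M_pos s hs.1
    have hv := h.v_pos hg hs.1
    have hgs := hg _ (h.ω_pos s hs.1)
    have hgg : g (ω s) ≤ g (ω t) :=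
      hanti (hωmem t ht) (hωmem s hs.1) (h.antitoneOn_ω hg hs.1 ht hs.2)
    have e : r s ^ (a - 1) = r s ^ (a + 1) / r s ^ 2 := by
      rw [← Real.rpow_natCast, ← Real.rpow_sub hr]; congr 1; push_cast; ring
    have h1 : r s ^ (a + 1) / r s ^ 2 * g (ω s) ≤ R ^ (a + 1) / r s ^ 2 * g (ω t) := by
      gcongr; exact hR s hs.1
    have h2 := mul_le_mul_of_nonneg_left h1 (by positivity : 0 ≤ 2 * M s * v s)
    rw [e]
    have e3 : 2 * R ^ (a + 1) * g (ω t) * (-(M s / r s ^ 2) * v s) =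
      -(2 * M s * v s * (R ^ (a + 1) / r s ^ 2 * g (ω t))) := by ring
    rw [e3]
    push_cast
    linarith
  have h1 := hdec (left_mem_Icc.2 ht) (right_mem_Icc.2 ht) ht
  simp only at h1
  have h2 : 0 ≤ 2 * R ^ (a + 1) * g (ω t) * ω t := by
    have := h.ω_pos t ht
    positivity
  linarith

theorem tendsto_u_atTop (h : NewtonianFlow a g r M ω v T) (ha : 1 < a)
    (hg : ∀ w, 0 < w → 0 < g w) {R : ℝ} (hR : ∀ t, T ≤ t → r t ≤ R)
    (hanti : AntitoneOn g (Ioc 0 (ω T))) (hgω : Tendsto (fun t => g (ω t)) atTop atTop) :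
    Tendsto (fun t => r t ^ a * g (ω t) / M t) atTop atTop := by
  have hrT := h.r_pos T le_rfl
  have hMT := h.M_pos T le_rfl
  have hωT := h.ω_pos T le_rfl
  have hR0 : 0 < R := hrT.trans_le (hR T le_rfl)
  set B := M T ^ 2 + 2 * R ^ (a + 1) * ω T with hB
  have hB0 : 0 < B := by positivity
  refine tendsto_atTop_mono' atTop ?_
    ((Real.tendsto_sqrt_atTop.comp hgω).const_mul_atTop (by positivity : 0 < r T ^ a / √B))
  filter_upwards [eventually_ge_atTop T, hgω.eventually_ge_atTop 1] with t ht hg1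
  have hM := h.M_pos t ht
  have hgt := hg _ (h.ω_pos t ht)
  have hMB : M t ≤ √B * √(g (ω t)) := by
    rw [← Real.sqrt_mul hB0.le]
    refine Real.le_sqrt_of_sq_le ((h.M_sq_le ha hg hR hanti ht).trans ?_)
    rw [hB]
    nlinarith [sq_nonneg (M T)]
  have hrm := h.monotoneOn_r hg self_mem_Ici ht ht
  have hs : 0 < √(g (ω t)) := Real.sqrt_pos.2 hgt
  calc r T ^ a / √B * √(g (ω t)) = r T ^ a * g (ω t) / (√B * √(g (ω t))) := by
        field_simp
        rw [Real.sq_sqrt hgt.le]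
    _ ≤ r t ^ a * g (ω t) / M t := by
        have hrt := h.r_pos t ht
        refine div_le_div₀ (by positivity) ?_ hM hMB
        gcongr

end NewtonianFlow

/-! ### Growth of `g` from bounds on its logarithmic derivative -/

section PowerBounds

variable {g : ℝ → ℝ} {w₀ k : ℝ}

/-- The derivative of `g w * w ^ (-k)` has the sign of `w g'(w) / g(w) - k`. -/
lemma hasDerivAt_mul_rpow_neg (hd : ∀ w, 0 < w → DifferentiableAt ℝ g w)
    (hg : ∀ w, 0 < w → 0 < g w) {w : ℝ} (hw : 0 < w) :
    HasDerivAt (fun w => g w * w ^ (-k))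
      (w ^ (-k - 1) * g w * (w * deriv g w / g w - k)) w := by
  have h := (hd w hw).hasDerivAt.fun_mul (Real.hasDerivAt_rpow_const (p := -k) (Or.inl hw.ne'))
  have hgw := (hg w hw).ne'
  refine h.congr_deriv ?_
  rw [Real.rpow_sub_one hw.ne']
  field_simp
  ring

lemma antitoneOn_mul_rpow_neg (hd : ∀ w, 0 < w → DifferentiableAt ℝ g w)
    (hg : ∀ w, 0 < w → 0 < g w) (hk : ∀ w ∈ Ioc 0 w₀, w * deriv g w / g w ≤ k) :
    AntitoneOn (fun w => g w * w ^ (-k)) (Ioc 0 w₀) :=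
  antitoneOn_of_hasDerivAt_nonpos (convex_Ioc 0 w₀)
    (fun _ hw => hasDerivAt_mul_rpow_neg hd hg hw.1)
    fun w hw => mul_nonpos_of_nonneg_of_nonpos
      (mul_nonneg (Real.rpow_nonneg hw.1.le _) (hg w hw.1).le) (sub_nonpos.2 (hk w hw))

lemma monotoneOn_mul_rpow_neg (hd : ∀ w, 0 < w → DifferentiableAt ℝ g w)
    (hg : ∀ w, 0 < w → 0 < g w) (hk : ∀ w ∈ Ioc 0 w₀, k ≤ w * deriv g w / g w) :
    MonotoneOn (fun w => g w * w ^ (-k)) (Ioc 0 w₀) :=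
  monotoneOn_of_hasDerivAt_nonneg (convex_Ioc 0 w₀)
    (fun _ hw => hasDerivAt_mul_rpow_neg hd hg hw.1)
    fun w hw => mul_nonneg
      (mul_nonneg (Real.rpow_nonneg hw.1.le _) (hg w hw.1).le) (sub_nonneg.2 (hk w hw))

lemma exists_mul_rpow_le (hw₀ : 0 < w₀) (hd : ∀ w, 0 < w → DifferentiableAt ℝ g w)
    (hg : ∀ w, 0 < w → 0 < g w) (hk : ∀ w ∈ Ioc 0 w₀, w * deriv g w / g w ≤ k) :
    ∃ c, 0 < c ∧ ∀ w ∈ Ioc 0 w₀, c * w ^ k ≤ g w := by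
  refine ⟨g w₀ * w₀ ^ (-k), mul_pos (hg w₀ hw₀) (Real.rpow_pos_of_pos hw₀ _), fun w hw => ?_⟩
  have h := antitoneOn_mul_rpow_neg hd hg hk hw ⟨hw₀, le_rfl⟩ hw.2
  simp only [Real.rpow_neg hw.1.le, ← div_eq_mul_inv] at h
  rwa [le_div_iff₀ (Real.rpow_pos_of_pos hw.1 _)] at h

lemma exists_le_mul_rpow (hw₀ : 0 < w₀) (hd : ∀ w, 0 < w → DifferentiableAt ℝ g w)
    (hg : ∀ w, 0 < w → 0 < g w) (hk : ∀ w ∈ Ioc 0 w₀, k ≤ w * deriv g w / g w) :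
    ∃ C, ∀ w ∈ Ioc 0 w₀, g w ≤ C * w ^ k := by
  refine ⟨g w₀ * w₀ ^ (-k), fun w hw => ?_⟩
  have h := monotoneOn_mul_rpow_neg hd hg hk hw ⟨hw₀, le_rfl⟩ hw.2
  simp only [Real.rpow_neg hw.1.le, ← div_eq_mul_inv] at h
  rwa [div_le_iff₀ (Real.rpow_pos_of_pos hw.1 _)] at h

lemma tendsto_zero_of_pos_le_logDeriv (hw₀ : 0 < w₀)
    (hd : ∀ w, 0 < w → DifferentiableAt ℝ g w) (hg : ∀ w, 0 < w → 0 < g w) (hk0 : 0 < k)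
    (hk : ∀ w ∈ Ioc 0 w₀, k ≤ w * deriv g w / g w) : Tendsto g (𝓝[>] 0) (𝓝 0) := by
  obtain ⟨C, hC⟩ := exists_le_mul_rpow hw₀ hd hg hk
  have hlim : Tendsto (fun w : ℝ => C * w ^ k) (𝓝[>] 0) (𝓝 0) := by
    have h : Tendsto (fun w : ℝ => C * w ^ k) (𝓝 0) (𝓝 (C * 0 ^ k)) :=
      ((Real.continuous_rpow_const hk0.le).tendsto 0).const_mul C
    rw [Real.zero_rpow hk0.ne', mul_zero] at h
    exact h.mono_left nhdsWithin_le_nhds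
  refine tendsto_of_tendsto_of_tendsto_of_le_of_le' tendsto_const_nhds hlim ?_ ?_
  · filter_upwards [self_mem_nhdsWithin] with w hw using (hg w hw).le
  · filter_upwards [Ioc_mem_nhdsGT hw₀] with w hw using hC w hw

lemma tendsto_atTop_of_logDeriv_le_neg (hw₀ : 0 < w₀)
    (hd : ∀ w, 0 < w → DifferentiableAt ℝ g w) (hg : ∀ w, 0 < w → 0 < g w) (hk0 : 0 < k)
    (hk : ∀ w ∈ Ioc 0 w₀, w * deriv g w / g w ≤ -k) : Tendsto g (𝓝[>] 0) atTop := by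
  obtain ⟨c, hc, hcg⟩ := exists_mul_rpow_le hw₀ hd hg hk
  refine tendsto_atTop_mono' _ ?_ ((tendsto_rpow_neg_nhdsGT_zero (y := -k)
    (neg_lt_zero.2 hk0)).const_mul_atTop hc)
  filter_upwards [Ioc_mem_nhdsGT hw₀] with w hw using hcg w hw

end PowerBounds

lemma mul_deriv_div_gFun_eq (φ : ℝ → ℝ) (l : ℝ) {ω : ℝ} (hω : 0 < ω) :
    ω * deriv (gFun φ (l + 1 / 2)) ω / gFun φ (l + 1 / 2) ω =
      polyIndexΩ φ l (ω / (1 + ω)) + l := by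
  have e : ω / (1 + ω) / (1 - ω / (1 + ω)) = ω := by
    have : 1 + ω ≠ 0 := by linarith
    field_simp
    ring
  rw [polyIndexΩ, e, polyIndex]
  ring

lemma div_one_add_mem_Ioc {Ω₀ ω : ℝ} (hΩ₀ : Ω₀ < 1) (hω : ω ∈ Ioc 0 (Ω₀ / (1 - Ω₀))) :
    ω / (1 + ω) ∈ Ioc 0 Ω₀ := by
  have h0 := hω.1
  have h1 := hω.2
  rw [le_div_iff₀ (by linarith)] at h1
  refine ⟨by positivity, ?_⟩
  rw [div_le_iff₀ (by linarith)]
  linarith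

/-! ### From the compactified variables to the Newtonian form -/

lemma hasDerivAt_pair_fst {E F : Type*} [NormedAddCommGroup E] [NormedSpace ℝ E]
    [NormedAddCommGroup F] [NormedSpace ℝ F] {f : ℝ → E × F} {f' : E × F} {t : ℝ}
    (h : HasDerivAt f f' t) : HasDerivAt (fun s => (f s).1) f'.1 t :=
  (hasFDerivAt_fst (𝕜 := ℝ) (p := f t)).comp_hasDerivAt t h

lemma hasDerivAt_pair_snd {E F : Type*} [NormedAddCommGroup E] [NormedSpace ℝ E]
    [NormedAddCommGroup F] [NormedSpace ℝ F] {f : ℝ → E × F} {f' : E × F} {t : ℝ}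
    (h : HasDerivAt f f' t) : HasDerivAt (fun s => (f s).2) f'.2 t :=
  (hasFDerivAt_snd (𝕜 := ℝ) (p := f t)).comp_hasDerivAt t h

/-- A logistic equation `f' = f (1 - f) k` becomes `y' = k y` for `y = f / (1 - f)`. -/
lemma hasDerivAt_odds {f : ℝ → ℝ} {k t : ℝ} (hf : HasDerivAt f (f t * (1 - f t) * k) t)
    (h1 : f t < 1) : HasDerivAt (fun s => f s / (1 - f s)) (f t / (1 - f t) * k) t := by
  have h := hf.fun_div (hf.const_sub 1) (by linarith : 1 - f t ≠ 0)
  have hne : 1 - f t ≠ 0 := by linarith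
  refine h.congr_deriv ?_
  field_simp
  ring

/-- In the homology invariants `u = U / (1 - U)`, `q = Q / (1 - Q)` and `ω = Ω / (1 - Ω)` the
radius is recovered from `u q ω / g(ω) = r ^ (a - 1)` and the mass from `M = q r ω`. The term of
`U'` containing the index is the logarithmic derivative of `g(ω)` along the orbit, so it drops
out of the derivatives of `r` and `M`. -/
theorem IsInteriorOrbit.exists_newtonianFlow {φ : ℝ → ℝ} {l t₀ : ℝ} {x : ℝ → ℝ × ℝ × ℝ}
    (hl : -1 < l) (hφ : AdmissibleProfile φ l) (hx : IsInteriorOrbit φ l t₀ x) :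
    ∃ r M ω v : ℝ → ℝ,
      NewtonianFlow (3 + 2 * l) (gFun φ (l + 1 / 2)) r M ω v (t₀ + 1) ∧
      ∀ t, t₀ + 1 ≤ t → ∃ u q : ℝ,
        u = r t ^ (3 + 2 * l) * gFun φ (l + 1 / 2) (ω t) / M t ∧ q = M t / (r t * ω t) ∧
        x t = (u / (1 + u), q / (1 + q), ω t / (1 + ω t)) := by
  set g := gFun φ (l + 1 / 2) with hgdef
  set u : ℝ → ℝ := fun t => (x t).1 / (1 - (x t).1) with hu
  set q : ℝ → ℝ := fun t => (x t).2.1 / (1 - (x t).2.1) with hq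
  set ω : ℝ → ℝ := fun t => (x t).2.2 / (1 - (x t).2.2) with hω
  set z : ℝ → ℝ := fun t => u t * q t * ω t / g (ω t) with hz
  set r : ℝ → ℝ := fun t => z t ^ (2 + 2 * l)⁻¹ with hr
  have hl2 : 0 < 2 + 2 * l := by linarith
  have hU : ∀ t, t₀ + 1 ≤ t → 0 < (x t).1 ∧ (x t).1 < 1 := fun t ht =>
    (hx.2 t (mem_Ici.2 (by linarith))).1
  have hQ : ∀ t, t₀ + 1 ≤ t → 0 < (x t).2.1 ∧ (x t).2.1 < 1 := fun t ht =>
    (hx.2 t (mem_Ici.2 (by linarith))).2.1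
  have hΩ : ∀ t, t₀ + 1 ≤ t → 0 < (x t).2.2 ∧ (x t).2.2 < 1 := fun t ht =>
    (hx.2 t (mem_Ici.2 (by linarith))).2.2
  have hu0 : ∀ t, t₀ + 1 ≤ t → 0 < u t := fun t ht =>
    div_pos (hU t ht).1 (by linarith [(hU t ht).2])
  have hq0 : ∀ t, t₀ + 1 ≤ t → 0 < q t := fun t ht =>
    div_pos (hQ t ht).1 (by linarith [(hQ t ht).2])
  have hω0 : ∀ t, t₀ + 1 ≤ t → 0 < ω t := fun t ht =>
    div_pos (hΩ t ht).1 (by linarith [(hΩ t ht).2])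
  have hg0 : ∀ t, t₀ + 1 ≤ t → 0 < g (ω t) := fun t ht => hφ.pos _ (hω0 t ht)
  have hz0 : ∀ t, t₀ + 1 ≤ t → 0 < z t := fun t ht =>
    div_pos (mul_pos (mul_pos (hu0 t ht) (hq0 t ht)) (hω0 t ht)) (hg0 t ht)
  have hr0 : ∀ t, t₀ + 1 ≤ t → 0 < r t := fun t ht => Real.rpow_pos_of_pos (hz0 t ht) _
  have hrz : ∀ t, t₀ + 1 ≤ t → r t ^ (2 + 2 * l) = z t := fun t ht =>
    Real.rpow_inv_rpow (hz0 t ht).le hl2.ne'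
  -- the orbit has only a one-sided derivative at `t₀`, so the flow is started at `t₀ + 1`
  have hderiv : ∀ t, t₀ + 1 ≤ t → HasDerivAt x (field φ l (x t)) t := fun t ht =>
    (hx.1 t (mem_Ici.2 (by linarith))).hasDerivAt (Ici_mem_nhds (by linarith))
  have hderiv₂ : ∀ t, t₀ + 1 ≤ t → HasDerivAt (fun s => (x s).2) (field φ l (x t)).2 t :=
    fun t ht => hasDerivAt_pair_snd (hderiv t ht)
  -- the equations for the homology invariants and the potential
  have hdu : ∀ t, t₀ + 1 ≤ t → HasDerivAt u (u t *
      ((1 - (x t).2.1) * (3 + 2 * l - (4 + 2 * l) * (x t).1)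
        - (ω t * deriv g (ω t) / g (ω t)) * (x t).2.1 * (1 - (x t).1))) t := fun t ht => by
    have h : HasDerivAt (fun s => (x s).1) (field φ l (x t)).1 t :=
      hasDerivAt_pair_fst (hderiv t ht)
    refine hasDerivAt_odds (h.congr_deriv ?_) (hU t ht).2
    simp [field, polyIndexΩ, polyIndex, hω, hgdef]
  have hdq : ∀ t, t₀ + 1 ≤ t → HasDerivAt q (q t *
      ((2 * (x t).1 - 1) * (1 - (x t).2.1) + (x t).2.1 * (1 - (x t).1))) t := fun t ht =>
    hasDerivAt_odds (f := fun s => (x s).2.1)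
      (hasDerivAt_pair_fst (hderiv₂ t ht)) (hQ t ht).2
  have hdω : ∀ t, t₀ + 1 ≤ t → HasDerivAt ω (ω t * -((x t).2.1 * (1 - (x t).1))) t :=
    fun t ht => by
    have h : HasDerivAt (fun s => (x s).2.2) (field φ l (x t)).2.2 t :=
      hasDerivAt_pair_snd (hderiv₂ t ht)
    refine hasDerivAt_odds (h.congr_deriv ?_) (hΩ t ht).2
    simp only [field]
    ring
  have hdz : ∀ t, t₀ + 1 ≤ t → HasDerivAt z
      (z t * ((2 + 2 * l) * ((1 - (x t).1) * (1 - (x t).2.1)))) t := fun t ht => by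
    have hdg := (hφ.differentiableAt_gFun hl (hω0 t ht)).hasDerivAt.comp t (hdω t ht)
    have h := (((hdu t ht).fun_mul (hdq t ht)).fun_mul (hdω t ht)).fun_div hdg (hg0 t ht).ne'
    refine h.congr_deriv ?_
    have h1 := (hg0 t ht).ne'
    simp only [hz, Function.comp_apply]
    rw [← hgdef]
    field_simp
    ring
  have hdr : ∀ t, t₀ + 1 ≤ t →
      HasDerivAt r (r t * ((1 - (x t).1) * (1 - (x t).2.1))) t := fun t ht => by
    have h := (hdz t ht).rpow_const (p := (2 + 2 * l)⁻¹) (Or.inl (hz0 t ht).ne')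
    refine h.congr_deriv ?_
    rw [Real.rpow_sub_one (hz0 t ht).ne']
    have h1 := (hz0 t ht).ne'
    have h2 := hl2.ne'
    change _ = z t ^ (2 + 2 * l)⁻¹ * _
    rw [show ∀ A B : ℝ, z t * ((2 + 2 * l) * A) * (2 + 2 * l)⁻¹ * (B / z t) =
      ((2 + 2 * l) * (2 + 2 * l)⁻¹) * (z t / z t) * (B * A) from fun A B => by ring,
      mul_inv_cancel₀ h2, div_self h1]
    ring
  have hra : ∀ t, t₀ + 1 ≤ t →
      r t ^ (3 + 2 * l) * g (ω t) / (q t * r t * ω t) = u t := fun t ht => by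
    rw [show 3 + 2 * l = (2 + 2 * l) + 1 by ring, Real.rpow_add_one (hr0 t ht).ne', hrz t ht]
    have h1 := (hg0 t ht).ne'
    have h2 := (hq0 t ht).ne'
    have h3 := (hr0 t ht).ne'
    have h4 := (hω0 t ht).ne'
    simp only [hz]
    field_simp
  have hqq : ∀ t, t₀ + 1 ≤ t → q t * r t * ω t / (r t * ω t) = q t := fun t ht => by
    have h3 := (hr0 t ht).ne'
    have h4 := (hω0 t ht).ne'
    field_simp
  have hU1 : ∀ t, t₀ + 1 ≤ t → 1 - (x t).1 ≠ 0 := fun t ht => by linarith [(hU t ht).2]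
  have hQ1 : ∀ t, t₀ + 1 ≤ t → 1 - (x t).2.1 ≠ 0 := fun t ht => by linarith [(hQ t ht).2]
  have hΩ1 : ∀ t, t₀ + 1 ≤ t → 1 - (x t).2.2 ≠ 0 := fun t ht => by linarith [(hΩ t ht).2]
  refine ⟨r, fun t => q t * r t * ω t, ω,
    fun t => r t * ((1 - (x t).1) * (1 - (x t).2.1)), ⟨hr0, ?_, hω0, ?_, hdr, ?_, ?_⟩, ?_⟩
  · exact fun t ht => mul_pos (mul_pos (hq0 t ht) (hr0 t ht)) (hω0 t ht)
  · intro t ht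
    rw [hra t ht, hqq t ht]
    have h1 := hU1 t ht
    have h2 := hQ1 t ht
    simp only [hu, hq]
    field_simp
    ring
  · intro t ht
    refine (((hdq t ht).fun_mul (hdr t ht)).fun_mul (hdω t ht)).congr_deriv ?_
    rw [show 3 + 2 * l - 1 = 2 + 2 * l by ring, hrz t ht]
    have h1 := (hg0 t ht).ne'
    have h2 := hU1 t ht
    have h3 := hQ1 t ht
    simp only [hz, hu, hq]
    field_simp
    ring
  · intro t ht
    refine (hdω t ht).congr_deriv ?_
    have h1 := (hr0 t ht).ne'
    have h2 := hU1 t ht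
    have h3 := hQ1 t ht
    simp only [hq]
    field_simp
  · intro t ht
    refine ⟨u t, q t, (hra t ht).symm, (hqq t ht).symm, ?_⟩
    have h1 := hU1 t ht
    have h2 := hQ1 t ht
    have h3 := hΩ1 t ht
    refine Prod.ext ?_ (Prod.ext ?_ ?_)
    · simp only [hu]; field_simp; ring
    · simp only [hq]; field_simp; ring
    · simp only [hω]; field_simp; ring

/-! ### Limits in the compactified variables -/

lemma tendsto_div_one_add_zero {α : Type*} {F : Filter α} {f : α → ℝ}
    (hf : Tendsto f F (𝓝 0)) : Tendsto (fun t => f t / (1 + f t)) F (𝓝 0) := by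
  have h : Tendsto (fun t => f t / (1 + f t)) F (𝓝 (0 / (1 + 0))) :=
    hf.div (hf.const_add 1) (by norm_num)
  simpa using h

lemma tendsto_div_one_add_one {α : Type*} {F : Filter α} {f : α → ℝ}
    (hf : Tendsto f F atTop) : Tendsto (fun t => f t / (1 + f t)) F (𝓝 1) := by
  have h : Tendsto (fun t => 1 - (1 + f t)⁻¹) F (𝓝 (1 - 0)) :=
    (tendsto_inv_atTop_zero.comp (tendsto_atTop_add_const_left F 1 hf)).const_sub 1
  rw [sub_zero] at h
  refine h.congr' ?_
  filter_upwards [hf.eventually_ge_atTop 0] with t ht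
  have : 1 + f t ≠ 0 := by linarith
  field_simp
  ring

lemma eq_of_mapClusterPt_of_tendsto {α X : Type*} [TopologicalSpace X] [T2Space X]
    {F : Filter α} {f : α → X} {b c : X} (hb : MapClusterPt b F f) (hc : Tendsto f F (𝓝 c)) :
    b = c := by
  have : (𝓝 b ⊓ 𝓝 c).NeBot := ClusterPt.mono hb hc
  exact eq_of_nhds_neBot this

lemma omegaLimitSet_eq_singleton {x : ℝ → ℝ × ℝ × ℝ} {p : ℝ × ℝ × ℝ}
    (h : Tendsto x atTop (𝓝 p)) : omegaLimitSet x = {p} := by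
  refine Subset.antisymm (fun b hb => eq_of_mapClusterPt_of_tendsto hb h) ?_
  rintro _ rfl
  exact h.mapClusterPt

/-- The data about an interior orbit from which the limits are read off when the index is at most
`3 + l` near the boundary: from some time on, `ω` lies in the range where the index is controlled,
it decays to zero, and the radius is bounded. -/
theorem IsInteriorOrbit.exists_finite_radius {φ : ℝ → ℝ} {l t₀ : ℝ} {x : ℝ → ℝ × ℝ × ℝ}
    (hl : -1 < l) (hφ : AdmissibleProfile φ l) (hx : IsInteriorOrbit φ l t₀ x) {Ω₀ : ℝ}
    (hΩ₀ : Ω₀ ∈ Ioo (0 : ℝ) 1) (hn : ∀ Ω ∈ Ioc 0 Ω₀, polyIndexΩ φ l Ω ≤ 3 + l) :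
    ∃ (r M ω v : ℝ → ℝ) (T R : ℝ),
      NewtonianFlow (3 + 2 * l) (gFun φ (l + 1 / 2)) r M ω v T ∧
      ω T ≤ Ω₀ / (1 - Ω₀) ∧ Tendsto ω atTop (𝓝[>] 0) ∧ (∀ t, T ≤ t → r t ≤ R) ∧
      Tendsto (fun t => (x t).2) atTop (𝓝 (1, 0)) ∧
      (fun t => (x t).1) =ᶠ[atTop] fun t =>
        (r t ^ (3 + 2 * l) * gFun φ (l + 1 / 2) (ω t) / M t) /
          (1 + r t ^ (3 + 2 * l) * gFun φ (l + 1 / 2) (ω t) / M t) := by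
  have ha : 1 < 3 + 2 * l := by linarith
  have hd : ∀ w, 0 < w → DifferentiableAt ℝ (gFun φ (l + 1 / 2)) w := fun w hw =>
    hφ.differentiableAt_gFun hl hw
  have hgc : ContinuousOn (gFun φ (l + 1 / 2)) (Ioi 0) := fun w hw =>
    (hd w hw).continuousAt.continuousWithinAt
  have hw₀ : 0 < Ω₀ / (1 - Ω₀) := div_pos hΩ₀.1 (by linarith [hΩ₀.2])
  obtain ⟨r, M, ω, v, hN, hxt⟩ := hx.exists_newtonianFlow hl hφ
  obtain ⟨c, hc, hcg⟩ := exists_mul_rpow_le (k := 3 + 2 * l) hw₀ hd hφ.pos fun w hw => by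
    rw [mul_deriv_div_gFun_eq φ l hw.1]
    linarith [hn _ (div_one_add_mem_Ioc hΩ₀.2 hw)]
  obtain ⟨T, hT, hωT⟩ := hN.exists_ω_lt ha hgc hφ.pos hw₀
  have hNT := hN.restart hT
  obtain ⟨R, hR⟩ := hNT.exists_r_le ha hφ.pos hc fun w hw => hcg w ⟨hw.1, hw.2.trans hωT.le⟩
  have hω := hN.tendsto_ω ha hgc hφ.pos
  refine ⟨r, M, ω, v, T, R, hNT, hωT.le, hω, hR, ?_, ?_⟩
  · refine Tendsto.congr' ?_ ((tendsto_div_one_add_one (hNT.tendsto_q hφ.pos hR hω)).prodMk_nhds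
      (tendsto_div_one_add_zero (hω.mono_right nhdsWithin_le_nhds)))
    filter_upwards [eventually_ge_atTop (t₀ + 1)] with t ht
    obtain ⟨u, q, -, rfl, h⟩ := hxt t ht
    rw [h]
  · filter_upwards [eventually_ge_atTop (t₀ + 1)] with t ht
    obtain ⟨u, q, rfl, -, h⟩ := hxt t ht
    rw [h]

end VlasovPoisson

theorem proposition2 (l : ℝ) (hl : -1 < l) (φ : ℝ → ℝ)
    (hφ : VlasovPoisson.AdmissibleProfile φ l) (Ω₀ : ℝ) (hΩ₀ : Ω₀ ∈ Set.Ioo (0 : ℝ) 1) :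
    ((∀ Ω ∈ Set.Ioc 0 Ω₀, VlasovPoisson.polyIndexΩ φ l Ω ≤ 3 + l) →
      ∀ (t₀ : ℝ) (x : ℝ → ℝ × ℝ × ℝ), VlasovPoisson.IsInteriorOrbit φ l t₀ x →
        VlasovPoisson.omegaLimitSet x ⊆ {p | p.2.1 = 1 ∧ p.2.2 = 0}) ∧
    (∀ ε : ℝ, 0 < ε →
      (∀ Ω ∈ Set.Ioc 0 Ω₀, -l + ε ≤ VlasovPoisson.polyIndexΩ φ l Ω ∧
        VlasovPoisson.polyIndexΩ φ l Ω ≤ 3 + l) →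
      ∀ (t₀ : ℝ) (x : ℝ → ℝ × ℝ × ℝ), VlasovPoisson.IsInteriorOrbit φ l t₀ x →
        VlasovPoisson.omegaLimitSet x = {(0, 1, 0)}) ∧
    (∀ ε : ℝ, 0 < ε →
      (∀ Ω ∈ Set.Ioc 0 Ω₀, VlasovPoisson.polyIndexΩ φ l Ω ≤ -l - ε) →
      ∀ (t₀ : ℝ) (x : ℝ → ℝ × ℝ × ℝ), VlasovPoisson.IsInteriorOrbit φ l t₀ x →
        VlasovPoisson.omegaLimitSet x = {(1, 1, 0)}) := by
  have hd : ∀ w, 0 < w → DifferentiableAt ℝ (VlasovPoisson.gFun φ (l + 1 / 2)) w := fun w hw =>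
    hφ.differentiableAt_gFun hl hw
  have hw₀ : 0 < Ω₀ / (1 - Ω₀) := div_pos hΩ₀.1 (by linarith [hΩ₀.2])
  refine ⟨fun hn t₀ x hx p hp => ?_, fun ε hε hn t₀ x hx => ?_, fun ε hε hn t₀ x hx => ?_⟩
  · obtain ⟨-, -, -, -, -, -, -, -, -, -, hlim, -⟩ := hx.exists_finite_radius hl hφ hΩ₀ hn
    have hp2 : MapClusterPt p.2 Filter.atTop fun t => (x t).2 :=
      MapClusterPt.continuousAt_comp continuousAt_snd hp
    have h := VlasovPoisson.eq_of_mapClusterPt_of_tendsto hp2 hlim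
    exact ⟨congrArg Prod.fst h, congrArg Prod.snd h⟩
  · obtain ⟨r, M, ω, v, T, R, hN, -, hω, hR, hlim, hU⟩ :=
      hx.exists_finite_radius hl hφ hΩ₀ fun Ω hΩ => (hn Ω hΩ).2
    have hg := VlasovPoisson.tendsto_zero_of_pos_le_logDeriv hw₀ hd hφ.pos hε fun w hw => by
      rw [VlasovPoisson.mul_deriv_div_gFun_eq φ l hw.1]
      linarith [(hn _ (VlasovPoisson.div_one_add_mem_Ioc hΩ₀.2 hw)).1]
    have hu := hN.tendsto_u_zero (by linarith) hφ.pos hR (hg.comp hω)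
    exact VlasovPoisson.omegaLimitSet_eq_singleton
      (((VlasovPoisson.tendsto_div_one_add_zero hu).congr' hU.symm).prodMk_nhds hlim)
  · obtain ⟨r, M, ω, v, T, R, hN, hωT, hω, hR, hlim, hU⟩ :=
      hx.exists_finite_radius hl hφ hΩ₀ fun Ω hΩ => (hn Ω hΩ).trans (by linarith)
    have hk : ∀ w ∈ Set.Ioc 0 (Ω₀ / (1 - Ω₀)), w * deriv (VlasovPoisson.gFun φ (l + 1 / 2)) w /
        VlasovPoisson.gFun φ (l + 1 / 2) w ≤ -ε := fun w hw => by
      rw [VlasovPoisson.mul_deriv_div_gFun_eq φ l hw.1]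
      linarith [hn _ (VlasovPoisson.div_one_add_mem_Ioc hΩ₀.2 hw)]
    have hg := VlasovPoisson.tendsto_atTop_of_logDeriv_le_neg hw₀ hd hφ.pos hε hk
    have hanti := VlasovPoisson.antitoneOn_mul_rpow_neg (k := 0) hd hφ.pos fun w hw =>
      (hk w hw).trans (by linarith)
    simp only [neg_zero, Real.rpow_zero, mul_one] at hanti
    have hu := hN.tendsto_u_atTop (by linarith) hφ.pos hR
      (hanti.mono (Set.Ioc_subset_Ioc_right hωT)) (hg.comp hω)
    exact VlasovPoisson.omegaLimitSet_eq_singleton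
      (((VlasovPoisson.tendsto_div_one_add_one hu).congr' hU.symm).prodMk_nhds hlim)
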